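/- Let $F$ be the free group on $x_1,\dots,x_r$ ($r\ge 0$), let $F^{(0)}=F$ and $F^{(k+1)}=[F^{(k)},F^{(k)}]$, and let $S_{k,r}=F/F^{(k)}$ be the free solvable group of class $k$ and rank $r$, generated by the images of $x_1,\dots,x_r$ (so $S_{0,r}$ is trivial). Let $\mathbb{Z}^r$ be the free abelian group with basis $a_1,\dots,a_r$. For $d\ge 1$ put $B=S_{d-1,r}$, and let $\mathbb{Z}^r\wr B$ be the restricted wreath product, i.e. the semidirect product of the group of finitely supported functions $B\to\mathbb{Z}^r$ and $B$, where $b\in B$ acts by $(b\cdot f)(x)=f(b^{-1}x)$. It is generated by $a_1,\dots,a_r,x_1,\dots,x_r$, where $a_i$ stands for the function with value $a_i$ at $1$ and $0$ elsewhere. Let $\partial/\partial x_i:F\to\mathbb{Z}[F]$ be the Fox derivatives, given by $\partial x_j/\partial x_i=\delta_{ij}$ and $\partial(uv)/\partial x_i=\partial u/\partial x_i+u\,\partial v/\partial x_i$. The Magnus embedding is the homomorphism $$\phi:S_{d,r}\to\mathbb{Z}^r\wr S_{d-1,r},\qquad \phi(g)=(f_g,\bar g),$$ where $\bar g$ is the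 image of $g\in F$ in $B$ and the $i$-th coordinate of $f_g(b)$ is the coefficient of $b$ in the image of $\partial g/\partial x_i$ in $\mathbb{Z}[B]$. Then, for all $d\ge 1$ and $r\ge 0$, $\phi$ is injective and it is a quasi-isometric embedding for the word metrics of the above generating sets: there are constants $L\ge 1$ and $C\ge 0$ with $L^{-1}\,\mathrm{dist}(g,h)-C\le \mathrm{dist}(\phi(g),\phi(h))\le L\,\mathrm{dist}(g,h)+C$ for all $g,h\in S_{d,r}$. More precisely, for the word lengths $\|\cdot\|$ with respect to these generating sets, $$\frac{1}{2(r+1)}\,\|w\|_{S_{d,r}}\le\|\phi(w)\|_{\mathbb{Z}^r\wr S_{d-1,r}}\le 3\,\|w\|_{S_{d,r}}\qquad\text{for all } w\in S_{d,r}.$$ -/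

import Mathlib

noncomputable section

namespace MagnusQI

/-! ### Word metrics and quasi-isometric embeddings -/

/-- The word length of `g` with respect to `S`: the least length of a word in the elements of `S`
and their inverses that represents `g`, i.e. the distance from `1` to `g` in the Cayley graph
whose edges are `(g, g * s)` for `s ∈ S`. It is used only for generating sets `S`. -/
def wordLength {G : Type*} [Group G] (S : Set G) (g : G) : ℕ :=
  sInf {n : ℕ | ∃ l : List G, (∀ x ∈ l, x ∈ S ∨ x⁻¹ ∈ S) ∧ l.prod = g ∧ l.length = n}

/-- For a generating set the infimum in `wordLength` is attained. -/
theorem wordLength_spec {G : Type*} [Group G] {S : Set G} (hS : Subgroup.closure S = ⊤) (g : G) :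
    ∃ l : List G, (∀ x ∈ l, x ∈ S ∨ x⁻¹ ∈ S) ∧ l.prod = g ∧ l.length = wordLength S g := by
  have hg : g ∈ (Subgroup.closure S).toSubmonoid := hS ▸ Subgroup.mem_top g
  rw [Subgroup.closure_toSubmonoid] at hg
  obtain ⟨l, hl, hp⟩ := Submonoid.exists_list_of_mem_closure hg
  exact Nat.sInf_mem (s := {n : ℕ | ∃ l : List G, (∀ x ∈ l, x ∈ S ∨ x⁻¹ ∈ S) ∧ l.prod = g ∧
    l.length = n}) ⟨_, l, hl, hp, rfl⟩

/-- The word metric: the distance between `g` and `h` in the Cayley graph of `G` with respect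
to `S`. -/
def wordDist {G : Type*} [Group G] (S : Set G) (g h : G) : ℝ :=
  wordLength S (g⁻¹ * h)

/-- `f` is a quasi-isometric embedding with respect to the metrics `dX` and `dY`. -/
def IsQuasiIsometricEmbedding {X Y : Type*} (dX : X → X → ℝ) (dY : Y → Y → ℝ) (f : X → Y) :
    Prop :=
  ∃ L C : ℝ, 1 ≤ L ∧ 0 ≤ C ∧ ∀ x y : X,
    L⁻¹ * dX x y - C ≤ dY (f x) (f y) ∧ dY (f x) (f y) ≤ L * dX x y + C

/-! ### The Fox derivatives -/

section Fox

variable {α : Type*} [DecidableEq α]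

/-- The Fox derivative of a word in the letters `x ^ {1, -1}`, for the letter `i`. -/
def foxWord (i : α) : List (α × Bool) → MonoidAlgebra ℤ (FreeGroup α)
  | [] => 0
  | (j, true) :: w =>
      (if j = i then 1 else 0) + MonoidAlgebra.of ℤ _ (FreeGroup.of j) * foxWord i w
  | (j, false) :: w =>
      -(if j = i then MonoidAlgebra.of ℤ _ (FreeGroup.of j)⁻¹ else 0) +
        MonoidAlgebra.of ℤ _ (FreeGroup.of j)⁻¹ * foxWord i w

theorem foxWord_append (i : α) (u v : List (α × Bool)) :
    foxWord i (u ++ v) = foxWord i u + MonoidAlgebra.of ℤ _ (FreeGroup.mk u) * foxWord i v := by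
  induction u with
  | nil => rw [List.nil_append, foxWord, ← FreeGroup.one_eq_mk, map_one, one_mul, zero_add]
  | cons a u ih =>
    obtain ⟨j, b⟩ := a
    have h : ∀ b, FreeGroup.mk ((j, b) :: u) = FreeGroup.mk [(j, b)] * FreeGroup.mk u := by
      intro b; simp [FreeGroup.mul_mk]
    cases b with
    | true =>
      have h' : FreeGroup.mk [(j, true)] = FreeGroup.of j := rfl
      rw [List.cons_append, foxWord, foxWord, ih, h, h', map_mul]
      noncomm_ring
    | false =>
      have h' : FreeGroup.mk [(j, false)] = (FreeGroup.of j)⁻¹ := rfl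
      rw [List.cons_append, foxWord, foxWord, ih, h, h', map_mul]
      noncomm_ring

theorem foxWord_step (i : α) (u v : List (α × Bool)) (h : FreeGroup.Red.Step u v) :
    foxWord i u = foxWord i v := by
  have hc : ∀ j : α, MonoidAlgebra.of ℤ (FreeGroup α) (FreeGroup.of j) *
      MonoidAlgebra.of ℤ (FreeGroup α) (FreeGroup.of j)⁻¹ = 1 := by
    intro j; rw [← map_mul, mul_inv_cancel, map_one]
  have hc' : ∀ j : α, MonoidAlgebra.of ℤ (FreeGroup α) (FreeGroup.of j)⁻¹ *
      MonoidAlgebra.of ℤ (FreeGroup α) (FreeGroup.of j) = 1 := by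
    intro j; rw [← map_mul, inv_mul_cancel, map_one]
  cases h with
  | @not u v j b =>
    rw [foxWord_append, foxWord_append]
    congr 2
    cases b
    · simp only [Bool.not_false, foxWord, mul_add, ← mul_assoc, hc', one_mul]
      split_ifs <;> simp
    · simp only [Bool.not_true, foxWord, mul_add, ← mul_assoc, hc, one_mul, mul_neg]
      split_ifs <;> simp [← MonoidAlgebra.one_def]

/-- The Fox derivative `∂ / ∂ x_i : F → ℤ[F]` on the free group `F` on `α`, characterised by
`∂ x_j / ∂ x_i = δ_ij` and `∂ (u v) / ∂ x_i = ∂ u / ∂ x_i + u ∂ v / ∂ x_i`. -/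
def foxDeriv (i : α) : FreeGroup α → MonoidAlgebra ℤ (FreeGroup α) :=
  Quot.lift (foxWord i) (foxWord_step i)

theorem foxDeriv_of (i j : α) : foxDeriv i (FreeGroup.of j) = if j = i then 1 else 0 := by
  change foxWord i [(j, true)] = _
  simp [foxWord]

theorem foxDeriv_mul (i : α) (u v : FreeGroup α) :
    foxDeriv i (u * v) = foxDeriv i u + MonoidAlgebra.of ℤ _ u * foxDeriv i v := by
  induction u using Quot.inductionOn with
  | h u => induction v using Quot.inductionOn with
    | h v => exact foxWord_append i u v

end Fox

/-! ### Wreath products -/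

section Wreath

variable (A B : Type*) [AddCommGroup A] [Group B]

/-- The action of `B` on the finitely supported functions `B → A` by translations,
`(b • f) x = f (b⁻¹ * x)`. -/
def translation : B →* MulAut (Multiplicative (B →₀ A)) where
  toFun b := AddEquiv.toMultiplicative (Finsupp.domCongr (Equiv.mulLeft b))
  map_one' := by
    ext f x
    change f.toAdd ((1 : B)⁻¹ * x) = f.toAdd x
    simp
  map_mul' b c := by
    ext f x
    change f.toAdd ((b * c)⁻¹ * x) = f.toAdd (c⁻¹ * (b⁻¹ * x))
    simp [mul_assoc]

/-- The (restricted) wreath product `A ≀ B` for an abelian group `A`, written additively: the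
semidirect product of the group of finitely supported functions `B → A` and `B`. -/
abbrev Wreath : Type _ := Multiplicative (B →₀ A) ⋊[translation A B] B

variable {A B}

/-- The embedding of `A` into `A ≀ B`: the element `a` is the function with value `a` at `1` and
value `0` elsewhere. -/
def wreathBase (a : A) : Wreath A B :=
  SemidirectProduct.inl (Multiplicative.ofAdd (Finsupp.single 1 a))

/-- The embedding of `B` into `A ≀ B`. -/
def wreathTop (b : B) : Wreath A B := SemidirectProduct.inr b

end Wreath

/-! ### The Magnus embedding -/

section Magnus

variable {r : ℕ} (N : Subgroup (FreeGroup (Fin r))) [N.Normal]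

/-- The image of the Fox derivative `∂ g / ∂ x_i` in `ℤ[F / N]`, as a finitely supported
function `F / N → ℤ`. -/
def foxImage (i : Fin r) (g : FreeGroup (Fin r)) : (FreeGroup (Fin r) ⧸ N) →₀ ℤ :=
  (MonoidAlgebra.mapDomainRingHom ℤ (QuotientGroup.mk' N) (foxDeriv i g)).coeff

/-- The element `a_1 ^ (∂ g / ∂ x_1) ⋯ a_r ^ (∂ g / ∂ x_r)` of the base group of
`ℤ ^ r ≀ (F / N)`: the function `F / N → ℤ ^ r` whose `i`-th component at `b` is the
coefficient of `b` in the image of `∂ g / ∂ x_i` in `ℤ[F / N]`. -/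
def magnusBase (g : FreeGroup (Fin r)) : (FreeGroup (Fin r) ⧸ N) →₀ (Fin r → ℤ) :=
  ∑ i, (foxImage N i g).mapRange (Pi.single i) (Pi.single_zero i)

theorem magnusBase_apply (g : FreeGroup (Fin r)) (b : FreeGroup (Fin r) ⧸ N) (i : Fin r) :
    magnusBase N g b i = foxImage N i g b := by
  simp [magnusBase, Finsupp.finsetSum_apply, Finset.sum_apply, Pi.single_apply]

theorem foxImage_mul (i : Fin r) (g h : FreeGroup (Fin r)) (b : FreeGroup (Fin r) ⧸ N) :
    foxImage N i (g * h) b =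
      foxImage N i g b + foxImage N i h ((g : FreeGroup (Fin r) ⧸ N)⁻¹ * b) := by
  have : MonoidAlgebra.mapDomainRingHom ℤ (QuotientGroup.mk' N) (MonoidAlgebra.of ℤ _ g) =
      MonoidAlgebra.single (g : FreeGroup (Fin r) ⧸ N) 1 := by
    simp
  rw [foxImage, foxDeriv_mul, map_add, map_mul, this]
  simp [foxImage]

/-- The homomorphism `F → ℤ ^ r ≀ (F / N)` that sends `g` to
`a_1 ^ (∂ g / ∂ x_1) ⋯ a_r ^ (∂ g / ∂ x_r) · ḡ`. -/
def magnusFree : FreeGroup (Fin r) →* Wreath (Fin r → ℤ) (FreeGroup (Fin r) ⧸ N) :=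
  MonoidHom.mk' (fun g => ⟨Multiplicative.ofAdd (magnusBase N g), g⟩) <| by
    intro g h
    refine SemidirectProduct.ext ?_ rfl
    refine Multiplicative.toAdd.injective (Finsupp.ext fun b => funext fun i => ?_)
    change magnusBase N (g * h) b i =
      magnusBase N g b i + magnusBase N h ((g : FreeGroup (Fin r) ⧸ N)⁻¹ * b) i
    simp only [magnusBase_apply, foxImage_mul]

theorem commutator_le_ker_magnusFree : ⁅N, N⁆ ≤ (magnusFree N).ker := by
  rw [Subgroup.commutator_le]
  intro g hg h hh
  have key : ∀ u ∈ N, magnusFree N u =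
      SemidirectProduct.inl (Multiplicative.ofAdd (magnusBase N u)) := by
    intro u hu
    refine SemidirectProduct.ext rfl ?_
    exact (QuotientGroup.eq_one_iff u).2 hu
  rw [MonoidHom.mem_ker, map_commutatorElement, commutatorElement_eq_one_iff_mul_comm,
    key g hg, key h hh]
  exact ((Commute.all (Multiplicative.ofAdd (magnusBase N g))
    (Multiplicative.ofAdd (magnusBase N h))).map SemidirectProduct.inl).eq

/-- The Magnus embedding `F / N' → ℤ ^ r ≀ (F / N)`, where `F` is the free group of rank `r`
and `N' = [N, N]`. -/
def magnus : FreeGroup (Fin r) ⧸ ⁅N, N⁆ →* Wreath (Fin r → ℤ) (FreeGroup (Fin r) ⧸ N) :=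
  QuotientGroup.lift ⁅N, N⁆ (magnusFree N) (commutator_le_ker_magnusFree N)

theorem magnus_mk (g : FreeGroup (Fin r)) :
    magnus N (g : FreeGroup (Fin r) ⧸ ⁅N, N⁆) =
      ⟨Multiplicative.ofAdd (magnusBase N g), (g : FreeGroup (Fin r) ⧸ N)⟩ := rfl

theorem magnus_of (i : Fin r) :
    magnus N (FreeGroup.of i : FreeGroup (Fin r)) =
      wreathBase (Pi.single i 1) * wreathTop ((FreeGroup.of i : FreeGroup (Fin r)) : _ ⧸ N) := by
  classical
  rw [magnus_mk]
  refine SemidirectProduct.ext ?_ (by simp [wreathBase, wreathTop])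
  refine Multiplicative.toAdd.injective (Finsupp.ext fun b => funext fun j => ?_)
  simp only [toAdd_ofAdd, magnusBase_apply, foxImage, foxDeriv_of, wreathBase, wreathTop,
    SemidirectProduct.mul_left, SemidirectProduct.left_inl, SemidirectProduct.left_inr, map_one,
    mul_one, Finsupp.single_apply]
  by_cases h : i = j
  · subst h
    simp [MonoidAlgebra.one_def, Finsupp.single_apply]
    split_ifs <;> simp
  · have h' : j ≠ i := fun e => h e.symm
    simp only [if_neg h, map_zero, MonoidAlgebra.coeff_zero]
    split_ifs <;> simp [h']

end Magnus

/-! ### Free solvable groups and their generating sets -/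

/-- The free solvable group `S_{d,r} = F / F^(d)` of class `d` and rank `r`, where `F^(d)` is the
`d`-th derived subgroup of the free group `F` of rank `r`. -/
abbrev FreeSolvable (d r : ℕ) : Type :=
  FreeGroup (Fin r) ⧸ derivedSeries (FreeGroup (Fin r)) d

/-- The generators `x_1, …, x_r` of `S_{d,r}`. -/
def freeSolvableGens (d r : ℕ) : Set (FreeSolvable d r) :=
  Set.range fun i : Fin r => ((FreeGroup.of i : FreeGroup (Fin r)) : FreeSolvable d r)

/-- The generators `a_1, …, a_r` of `ℤ ^ r` and `x_1, …, x_r` of `S_{d,r}`, in `ℤ ^ r ≀ S_{d,r}`. -/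
def wreathGens (d r : ℕ) : Set (Wreath (Fin r → ℤ) (FreeSolvable d r)) :=
  (Set.range fun i : Fin r => wreathBase (Pi.single i 1)) ∪ wreathTop '' freeSolvableGens d r

/-- The Magnus embedding `S_{d+1,r} → ℤ ^ r ≀ S_{d,r}`: the case `N = F^(d)`, where
`N' = F^(d+1)`. -/
def freeSolvableMagnus (d r : ℕ) :
    FreeSolvable (d + 1) r →* Wreath (Fin r → ℤ) (FreeSolvable d r) :=
  magnus (derivedSeries (FreeGroup (Fin r)) d)

theorem closure_freeSolvableGens (d r : ℕ) : Subgroup.closure (freeSolvableGens d r) = ⊤ := by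
  have h := congrArg (Subgroup.map (QuotientGroup.mk' (derivedSeries (FreeGroup (Fin r)) d)))
    (FreeGroup.closure_range_of (Fin r))
  rw [MonoidHom.map_closure, ← Set.range_comp,
    Subgroup.map_top_of_surjective _ (QuotientGroup.mk'_surjective _)] at h
  exact h

theorem closure_wreathGens (d r : ℕ) : Subgroup.closure (wreathGens d r) = ⊤ := by
  set K := Subgroup.closure (wreathGens d r) with hK
  have hB : ∀ b : FreeSolvable d r, (SemidirectProduct.inr b : Wreath (Fin r → ℤ) _) ∈ K := by
    intro b
    have : Subgroup.closure (freeSolvableGens d r) ≤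
        K.comap (SemidirectProduct.inr : _ →* Wreath (Fin r → ℤ) (FreeSolvable d r)) := by
      rw [Subgroup.closure_le]
      intro x hx
      exact Subgroup.subset_closure (Or.inr ⟨x, hx, rfl⟩)
    exact this (closure_freeSolvableGens d r ▸ Subgroup.mem_top b)
  have hA : ∀ f : FreeSolvable d r →₀ (Fin r → ℤ),
      (SemidirectProduct.inl (Multiplicative.ofAdd f) : Wreath (Fin r → ℤ) _) ∈ K := by
    intro f
    induction f using Finsupp.induction_linear with
    | zero => rw [ofAdd_zero, map_one]; exact K.one_mem
    | add f g hf hg => rw [ofAdd_add, map_mul]; exact K.mul_mem hf hg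
    | single b a =>
      have h1 : (wreathBase a : Wreath (Fin r → ℤ) (FreeSolvable d r)) ∈ K := by
        have ha : a = ∑ i, a i • (Pi.single i 1 : Fin r → ℤ) := by
          ext j; simp [Finset.sum_apply, Pi.single_apply]
        let ψ : Multiplicative (Fin r → ℤ) →* Wreath (Fin r → ℤ) (FreeSolvable d r) :=
          SemidirectProduct.inl.comp
            (AddMonoidHom.toMultiplicative (Finsupp.singleAddHom (1 : FreeSolvable d r)))
        change Multiplicative.ofAdd a ∈ K.comap ψ
        rw [ha, ofAdd_sum]
        refine Subgroup.prod_mem _ fun i _ => ?_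
        have hi : Multiplicative.ofAdd (Pi.single i 1 : Fin r → ℤ) ∈ K.comap ψ :=
          Subgroup.subset_closure (Or.inl ⟨i, rfl⟩)
        rw [ofAdd_zsmul]
        exact Subgroup.zpow_mem _ hi _
      have h2 : (SemidirectProduct.inl (Multiplicative.ofAdd (Finsupp.single b a)) :
          Wreath (Fin r → ℤ) (FreeSolvable d r)) =
          SemidirectProduct.inr b * wreathBase a * (SemidirectProduct.inr b)⁻¹ := by
        rw [wreathBase, ← map_inv, ← SemidirectProduct.inl_aut]
        congr 1
        change _ = Multiplicative.ofAdd (Finsupp.equivMapDomain (Equiv.mulLeft b) _)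
        simp
      rw [h2]
      exact K.mul_mem (K.mul_mem (hB b) h1) (K.inv_mem (hB b))
  rw [eq_top_iff]
  intro x _
  rw [← SemidirectProduct.inl_left_mul_inr_right x]
  exact K.mul_mem (hA x.left.toAdd) (hB x.right)

end MagnusQI

end

/-! A function `B → ℤ ^ r` is an integer flow on the Cayley graph of `B = F / N`: coordinate `i` at
`b` is the amount carried by the edge from `b` to `b * x i`. The product rule for Fox derivatives
says that the base part of `φ(g)` is the signed count of edge crossings of the walk from `1` that
reads a word for `g` (`toFlow_magnusBase_mk`).

Injectivity: sending an edge to the class of its Schreier generator extends linearly from flows to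
the abelianization of `N`. If `φ(g) = 1` then `g` lies in `N` and its flow vanishes, so a conjugate
of `g` is trivial in `N / [N, N]`.

Lower bound: a word of length `n` for `φ(w) = (f, ḡ)` traces a walk `p` from `1` to `ḡ` with `|p| +
‖f‖ ≤ n`, and `f` lives on edges that start at vertices of `p` (`exists_walk_of_wreath_word`). Since
`f` and the flow of `p` have the same boundary, their difference is a circulation, and each of its
edges meets `p`. It splits into closed walks that can be spliced into `p` (`exists_walk_add`). The
resulting walk has flow `f`, ends at `ḡ`, and has length at most `2|p| + ‖f‖ ≤ 2n`; by injectivity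
its word represents `w`. This gives the constant `2`, which is at most `2(r + 1)`.

Upper bound: `φ(x_i) = a_i x_i` has length at most `2`. -/

noncomputable section

namespace MagnusQI

/-! ### Flows on Cayley graphs -/

section Flow

variable {B ι : Type*} [Group B] (x : ι → B)

/-- The group element represented by a letter `x_i ^ {1, -1}`. -/
def letterVal (a : ι × Bool) : B := if a.2 then x a.1 else (x a.1)⁻¹

/-- The group element represented by a word. -/
def wordVal (l : List (ι × Bool)) : B := (l.map (letterVal x)).prod

@[simp] theorem wordVal_nil : wordVal x [] = 1 := rfl

@[simp] theorem wordVal_cons (a : ι × Bool) (l : List (ι × Bool)) :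
    wordVal x (a :: l) = letterVal x a * wordVal x l := by simp [wordVal]

@[simp] theorem wordVal_append (u v : List (ι × Bool)) :
    wordVal x (u ++ v) = wordVal x u * wordVal x v := by simp [wordVal]

/-- The edge of the Cayley graph, with its orientation label, that is crossed when the letter `a`
is read at the vertex `b`. The edge `(b, i)` joins `b` to `b * x i`. -/
def stepEdge (b : B) (a : ι × Bool) : B × ι := if a.2 then (b, a.1) else (b * (x a.1)⁻¹, a.1)

/-- The sign with which a letter crosses its edge. -/
def letterSign (a : ι × Bool) : ℤ := if a.2 then 1 else -1

/-- The flow of a single step from the vertex `b`. -/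
def stepFlow (b : B) (a : ι × Bool) : B × ι →₀ ℤ := Finsupp.single (stepEdge x b a) (letterSign a)

/-- The flow of the walk from `b` that reads the given word. -/
def walkFlow : B → List (ι × Bool) → (B × ι →₀ ℤ)
  | _, [] => 0
  | b, a :: l => stepFlow x b a + walkFlow (b * letterVal x a) l

@[simp] theorem walkFlow_nil (b : B) : walkFlow x b [] = 0 := rfl

@[simp] theorem walkFlow_cons (b : B) (a : ι × Bool) (l : List (ι × Bool)) :
    walkFlow x b (a :: l) = stepFlow x b a + walkFlow x (b * letterVal x a) l := rfl

theorem walkFlow_append (b : B) (u v : List (ι × Bool)) :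
    walkFlow x b (u ++ v) = walkFlow x b u + walkFlow x (b * wordVal x u) v := by
  induction u generalizing b with
  | nil => simp
  | cons a u ih => simp [ih, add_assoc, mul_assoc]

open Classical in
/-- The boundary of a flow. -/
def boundary : (B × ι →₀ ℤ) →+ (B → ℤ) :=
  Finsupp.liftAddHom fun e =>
    (smulAddHom ℤ (B → ℤ)).flip (Pi.single (e.1 * x e.2) 1 - Pi.single e.1 1)

open Classical in
theorem boundary_stepFlow (b : B) (a : ι × Bool) :
    boundary x (stepFlow x b a) = Pi.single (b * letterVal x a) 1 - Pi.single b 1 := by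
  rw [boundary, stepFlow, Finsupp.liftAddHom_apply_single]
  obtain ⟨i, _ | _⟩ := a
  · simp [stepEdge, letterSign, letterVal, neg_add_eq_sub]
  · simp [stepEdge, letterSign, letterVal]

open Classical in
theorem boundary_walkFlow (b : B) (l : List (ι × Bool)) :
    boundary x (walkFlow x b l) = Pi.single (b * wordVal x l) 1 - Pi.single b 1 := by
  induction l generalizing b with
  | nil => simp
  | cons a l ih => rw [walkFlow_cons, map_add, boundary_stepFlow, ih]; simp [mul_assoc]

/-! ### The norm of a flow and the removal of steps -/

/-- The total amount of a flow. -/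
def flowNorm {E : Type*} (f : E →₀ ℤ) : ℕ := f.sum fun _ n => n.natAbs

theorem flowNorm_add_le {E : Type*} (f g : E →₀ ℤ) :
    flowNorm (f + g) ≤ flowNorm f + flowNorm g := by
  classical
  have h : ∀ k : E →₀ ℤ, k.support ⊆ f.support ∪ g.support →
      flowNorm k = ∑ e ∈ f.support ∪ g.support, (k e).natAbs := fun k hk =>
    Finsupp.sum_of_support_subset _ hk _ (by simp)
  rw [h _ Finsupp.support_add, h f Finset.subset_union_left, h g Finset.subset_union_right,
    ← Finset.sum_add_distrib]
  exact Finset.sum_le_sum fun e _ => Int.natAbs_add_le _ _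

theorem flowNorm_neg {E : Type*} (f : E →₀ ℤ) : flowNorm (-f) = flowNorm f := by
  simp [flowNorm, Finsupp.sum_neg_index]

theorem flowNorm_single {E : Type*} (e : E) (n : ℤ) :
    flowNorm (Finsupp.single e n) = n.natAbs := by
  simp [flowNorm]

theorem flowNorm_stepFlow (b : B) (a : ι × Bool) : flowNorm (stepFlow x b a) = 1 := by
  rw [stepFlow, flowNorm_single, letterSign]; split_ifs <;> rfl

theorem flowNorm_walkFlow_le (b : B) (l : List (ι × Bool)) :
    flowNorm (walkFlow x b l) ≤ l.length := by
  induction l generalizing b with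
  | nil => simp [flowNorm]
  | cons a l ih =>
    have h := flowNorm_add_le (stepFlow x b a) (walkFlow x (b * letterVal x a) l)
    rw [flowNorm_stepFlow] at h
    have := ih (b * letterVal x a)
    rw [walkFlow_cons, List.length_cons]
    omega

/-- Removing a step along which the flow runs. -/
theorem flowNorm_sub_stepFlow (f : B × ι →₀ ℤ) (b : B) (a : ι × Bool)
    (h : 0 < letterSign a * f (stepEdge x b a)) :
    flowNorm (f - stepFlow x b a) + 1 = flowNorm f := by
  classical
  set e := stepEdge x b a with he
  have hs : e ∈ f.support := by
    rw [Finsupp.mem_support_iff]; intro h0; simp [h0] at h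
  have hsub : (f - stepFlow x b a).support ⊆ f.support := by
    intro c hc
    by_contra hcf
    have hce : c ≠ e := fun h => hcf (h ▸ hs)
    rw [Finsupp.mem_support_iff] at hc
    rw [Finsupp.notMem_support_iff] at hcf
    simp [stepFlow, ← he, hcf, hce.symm] at hc
  rw [flowNorm, Finsupp.sum_of_support_subset _ hsub _ (by simp), flowNorm, Finsupp.sum,
    ← Finset.add_sum_erase _ _ hs, ← Finset.add_sum_erase _ (fun c => (f c).natAbs) hs]
  have h1 : ∑ c ∈ f.support.erase e, ((f - stepFlow x b a) c).natAbs =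
      ∑ c ∈ f.support.erase e, (f c).natAbs := by
    refine Finset.sum_congr rfl fun c hc => ?_
    simp [stepFlow, ← he, (Finset.ne_of_mem_erase hc).symm]
  -- By `h`, `f e` is nonzero with the sign of the letter, so subtracting that sign brings it one
  -- closer to zero.
  have h2 : ((f - stepFlow x b a) e).natAbs + 1 = (f e).natAbs := by
    simp only [stepFlow, ← he, Finsupp.sub_apply, Finsupp.single_eq_same]
    unfold letterSign at h ⊢
    split_ifs at h ⊢ <;> omega
  omega

/-- Used to keep the support from growing, so that what remains of a circulation still meets the
walk into which it is spliced. -/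
theorem support_sub_stepFlow (f : B × ι →₀ ℤ) (b : B) (a : ι × Bool)
    (h : 0 < letterSign a * f (stepEdge x b a)) (e : B × ι) (he : f e = 0) :
    (f - stepFlow x b a) e = 0 := by
  have : stepEdge x b a ≠ e := by rintro rfl; simp [he] at h
  simp [stepFlow, he, this]

/-- If no step out of `b` runs along the flow, then `f` is nonpositive on edges leaving `b` and
nonnegative on edges entering it, so every term of the boundary at `b` is nonnegative. -/
theorem exists_step_of_boundary_neg (f : B × ι →₀ ℤ) (b : B) (h : boundary x f b < 0) :
    ∃ a : ι × Bool, 0 < letterSign a * f (stepEdge x b a) := by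
  classical
  by_contra! hc
  refine absurd h (not_lt.2 ?_)
  rw [boundary, Finsupp.liftAddHom_apply, Finsupp.sum, Finset.sum_apply]
  refine Finset.sum_nonneg fun e _ => ?_
  obtain ⟨c, i⟩ := e
  have h1 := hc (i, true)
  have h2 := hc (i, false)
  simp only [letterSign, stepEdge, if_true, one_mul, Bool.false_eq_true, if_false] at h1 h2
  simp only [AddMonoidHom.flip_apply, smulAddHom_apply, Pi.smul_apply, Pi.sub_apply,
    Pi.single_apply, smul_eq_mul]
  -- The cases are: a loop at `b`, which cancels; an edge entering `b`; an edge leaving `b`; an edge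
  -- away from `b`.
  by_cases e1 : b = c * x i <;> by_cases e2 : b = c
  · simp only [if_pos e1, if_pos e2]; simp
  · rw [e1, mul_inv_cancel_right] at h2
    rw [if_pos e1, if_neg e2]; omega
  · subst e2
    rw [if_neg e1, if_pos rfl]; omega
  · simp only [if_neg e1, if_neg e2]; simp

open Classical in
/-- A flow from `b` to `c` contains a walk from `b` to `c`. -/
theorem exists_walk_of_boundary (n : ℕ) (f : B × ι →₀ ℤ) (hn : flowNorm f = n) (b c : B)
    (h : boundary x f = Pi.single c 1 - Pi.single b 1) :
    ∃ l : List (ι × Bool), b * wordVal x l = c ∧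
      flowNorm (f - walkFlow x b l) + l.length = flowNorm f ∧
      ∀ e, f e = 0 → (f - walkFlow x b l) e = 0 := by
  induction n generalizing f b with
  | zero =>
    by_cases hbc : b = c
    · exact ⟨[], by simp [hbc], by simp, by simp⟩
    · obtain ⟨a, ha⟩ := exists_step_of_boundary_neg x f b (by simp [h, hbc])
      have := flowNorm_sub_stepFlow x f b a ha
      omega
  | succ n ih =>
    by_cases hbc : b = c
    · exact ⟨[], by simp [hbc], by simp, by simp⟩
    -- The boundary at `b` is `-1`. Removing a step along the flow leaves a flow of smaller norm
    -- from the head of that step to `c`.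
    · obtain ⟨a, ha⟩ := exists_step_of_boundary_neg x f b (by simp [h, hbc])
      have h1 := flowNorm_sub_stepFlow x f b a ha
      obtain ⟨l, hl, hl1, hl2⟩ := ih (f - stepFlow x b a) (by omega) (b * letterVal x a)
        (by rw [map_sub, h, boundary_stepFlow]; abel)
      refine ⟨a :: l, by rw [wordVal_cons, ← mul_assoc, hl], ?_, fun e he => ?_⟩
      · rw [walkFlow_cons, ← sub_sub, List.length_cons]; omega
      · rw [walkFlow_cons, ← sub_sub]
        exact hl2 e (support_sub_stepFlow x f b a ha e he)

/-- A circulation contains a closed walk at each end of each edge of its support. -/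
theorem exists_closed_walk (f : B × ι →₀ ℤ) (hf : boundary x f = 0) (e : B × ι) (he : f e ≠ 0)
    (b : B) (hb : b = e.1 ∨ b = e.1 * x e.2) :
    ∃ l : List (ι × Bool), l ≠ [] ∧ wordVal x l = 1 ∧
      flowNorm (f - walkFlow x b l) + l.length = flowNorm f ∧
      ∀ e, f e = 0 → (f - walkFlow x b l) e = 0 := by
  classical
  -- Orient `e` in the direction of the flow: `c` is the tail of the step, and `b` is its tail or
  -- its head.
  obtain ⟨c, a, hca, ha, hb⟩ : ∃ c a, stepEdge x c a = e ∧ 0 < letterSign a * f e ∧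
      (b = c ∨ b = c * letterVal x a) := by
    obtain ⟨c, i⟩ := e
    rcases lt_or_gt_of_ne he with h | h
    · exact ⟨c * x i, (i, false), by simp [stepEdge], by simpa [letterSign] using h,
        by simpa [letterVal] using hb.symm⟩
    · exact ⟨c, (i, true), by simp [stepEdge], by simpa [letterSign] using h,
        by simpa [letterVal] using hb⟩
  rw [← hca] at ha
  have h1 := flowNorm_sub_stepFlow x f c a ha
  -- Without this step the circulation becomes a flow from its head back to its tail, which contains
  -- a return walk.
  obtain ⟨l, hl, hl1, hl2⟩ := exists_walk_of_boundary x _ (f - stepFlow x c a) rfl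
    (c * letterVal x a) c (by rw [map_sub, hf, boundary_stepFlow]; abel)
  have hl' : letterVal x a * wordVal x l = 1 := by
    rwa [mul_assoc, mul_eq_left] at hl
  rcases hb with rfl | rfl
  · refine ⟨a :: l, by simp, by rw [wordVal_cons, hl'], ?_, fun e he => ?_⟩
    · rw [walkFlow_cons, ← sub_sub, List.length_cons]; omega
    · rw [walkFlow_cons, ← sub_sub]
      exact hl2 e (support_sub_stepFlow x f b a ha e he)
  -- When `b` is the head, the same closed walk is read from there, with `a` last.
  · have hw : f - walkFlow x (c * letterVal x a) (l ++ [a]) =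
        f - stepFlow x c a - walkFlow x (c * letterVal x a) l := by
      rw [walkFlow_append, hl, walkFlow_cons, walkFlow_nil]; abel
    refine ⟨l ++ [a], by simp, ?_, ?_, fun e he => ?_⟩
    · simpa using mul_eq_one_comm.1 hl'
    · rw [hw, List.length_append, List.length_singleton]; omega
    · rw [hw]
      exact hl2 e (support_sub_stepFlow x f c a ha e he)

/-! ### Splicing circulations into a walk -/

/-- The walk from `1` that reads `l` visits `b`. -/
def Visits (l : List (ι × Bool)) (b : B) : Prop := ∃ u v, l = u ++ v ∧ wordVal x u = b

theorem visits_end (l : List (ι × Bool)) : Visits x l (wordVal x l) := ⟨l, [], by simp, rfl⟩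

theorem Visits.append {l : List (ι × Bool)} {b : B} (h : Visits x l b) (m : List (ι × Bool)) :
    Visits x (l ++ m) b := by
  obtain ⟨u, v, rfl, h⟩ := h
  exact ⟨u, v ++ m, by simp, h⟩

/-- A detour along a closed walk returns to its starting vertex, so the later prefixes still end
where they did. -/
theorem Visits.insert {u c v : List (ι × Bool)} (hc : wordVal x c = 1) {b : B}
    (h : Visits x (u ++ v) b) : Visits x (u ++ c ++ v) b := by
  obtain ⟨s, t, h, hs⟩ := h
  rcases List.append_eq_append_iff.1 h with ⟨w, h1, h2⟩ | ⟨w, h1, h2⟩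
  · exact ⟨u ++ c ++ w, t, by simp [h2], by simp [hc, ← hs, h1]⟩
  · exact ⟨s, w ++ c ++ v, by simp [h1], hs⟩

/-- Nonzero flow means that some step crossed the edge; it started at the first end for a letter
`x_i` and at the second for `x_i⁻¹`. -/
theorem visits_of_walkFlow_ne_zero (l : List (ι × Bool)) (e : B × ι)
    (he : walkFlow x 1 l e ≠ 0) : Visits x l e.1 ∨ Visits x l (e.1 * x e.2) := by
  induction l using List.reverseRecOn with
  | nil => simp at he
  | append_singleton l a ih =>
    by_cases h : walkFlow x 1 l e = 0
    · rw [walkFlow_append, Finsupp.add_apply, h, zero_add, walkFlow_cons, walkFlow_nil, add_zero,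
        one_mul, stepFlow] at he
      have : stepEdge x (wordVal x l) a = e := by
        by_contra hne; simp [hne] at he
      subst this
      obtain ⟨i, _ | _⟩ := a
      · right; simpa [stepEdge] using (visits_end x l).append x _
      · left; simpa [stepEdge] using (visits_end x l).append x _
    · exact (ih h).imp (fun h => h.append x _) fun h => h.append x _

/-- A circulation all of whose edges meet a walk can be inserted into the walk. -/
theorem exists_walk_add (n : ℕ) (f : B × ι →₀ ℤ) (hn : flowNorm f ≤ n) (hf : boundary x f = 0)
    (l : List (ι × Bool))
    (hl : ∀ e, f e ≠ 0 → Visits x l e.1 ∨ Visits x l (e.1 * x e.2)) :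
    ∃ m : List (ι × Bool), walkFlow x 1 m = walkFlow x 1 l + f ∧ wordVal x m = wordVal x l ∧
      m.length ≤ l.length + flowNorm f := by
  induction n generalizing f l with
  | zero =>
    have : f = 0 := by
      ext e
      by_contra he
      obtain ⟨c, hc, -, h, -⟩ := exists_closed_walk x f hf e he _ (Or.inl rfl)
      have := List.length_pos_iff.2 hc
      omega
    exact ⟨l, by simp [this], rfl, by simp⟩
  | succ n ih =>
    by_cases h0 : f = 0
    · exact ⟨l, by simp [h0], rfl, by simp⟩
    obtain ⟨e, he⟩ : ∃ e, f e ≠ 0 := by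
      by_contra! h; exact h0 (Finsupp.ext h)
    obtain ⟨b, hb, u, v, rfl, hu⟩ : ∃ b, (b = e.1 ∨ b = e.1 * x e.2) ∧ Visits x l b := by
      rcases hl e he with h | h
      · exact ⟨_, Or.inl rfl, h⟩
      · exact ⟨_, Or.inr rfl, h⟩
    obtain ⟨c, hc, hc1, hc2, hc3⟩ := exists_closed_walk x f hf e he b hb
    have := List.length_pos_iff.2 hc
    -- Splice the closed walk `c` in at `b`. The rest of the circulation has norm smaller by
    -- `c.length`, which pays exactly for the longer walk.
    obtain ⟨m, hm, hm1, hm2⟩ := ih (f - walkFlow x b c) (by omega)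
      (by rw [map_sub, hf, boundary_walkFlow, hc1]; simp) (u ++ c ++ v)
      (fun e he => (hl e fun h => he (hc3 e h)).imp (Visits.insert x hc1) (Visits.insert x hc1))
    refine ⟨m, ?_, ?_, ?_⟩
    · rw [hm]
      simp only [walkFlow_append, wordVal_append, hc1, one_mul, mul_one, hu]
      abel
    · rw [hm1]; simp [hc1]
    · simp only [List.length_append] at hm2 ⊢
      omega

end Flow

/-! ### Flows and the Magnus embedding -/

section FlowMagnus

/-- A function `B → ℤ ^ r`, seen as a flow on the Cayley graph of `B`. -/
def toFlow {B : Type*} {r : ℕ} : (B →₀ (Fin r → ℤ)) →+ (B × Fin r →₀ ℤ) :=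
  Finsupp.liftAddHom fun b =>
    ∑ i, (Finsupp.singleAddHom (b, i)).comp (Pi.evalAddMonoidHom (fun _ => ℤ) i)

theorem toFlow_single {B : Type*} {r : ℕ} (b : B) (i : Fin r) (n : ℤ) :
    toFlow (Finsupp.single b (Pi.single i n)) = Finsupp.single (b, i) n := by
  rw [toFlow, Finsupp.liftAddHom_apply_single, AddMonoidHom.finsetSum_apply,
    Finset.sum_eq_single i]
  · simp
  · intro j _ hj; simp [hj]
  · simp

theorem toFlow_apply {B : Type*} {r : ℕ} (f : B →₀ (Fin r → ℤ)) (b : B) (i : Fin r) :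
    toFlow f (b, i) = f b i := by
  classical
  induction f using Finsupp.induction_linear with
  | zero => simp
  | add f g hf hg => simp [hf, hg]
  | single c v =>
    rw [toFlow, Finsupp.liftAddHom_apply_single, AddMonoidHom.finsetSum_apply,
      Finsupp.finsetSum_apply]
    by_cases h : c = b
    · subst h
      rw [Finset.sum_eq_single i]
      · simp
      · intro j _ hj; simp [hj]
      · simp
    · rw [Finsupp.single_apply, if_neg h]
      exact Finset.sum_eq_zero fun j _ => by simp [h]

theorem toFlow_injective {B : Type*} {r : ℕ} :
    Function.Injective (toFlow : (B →₀ (Fin r → ℤ)) →+ (B × Fin r →₀ ℤ)) := by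
  intro f g h
  ext b i
  rw [← toFlow_apply, h, toFlow_apply]

variable {r : ℕ} (N : Subgroup (FreeGroup (Fin r))) [N.Normal]

/-- The images of the generators of the free group in `F / N`. -/
def quotGen (i : Fin r) : FreeGroup (Fin r) ⧸ N := (FreeGroup.of i : FreeGroup (Fin r))

theorem mk_singleton (a : Fin r × Bool) : FreeGroup.mk [a] = letterVal FreeGroup.of a := by
  obtain ⟨i, _ | _⟩ := a <;> rfl

theorem mk_cons (a : Fin r × Bool) (l : List (Fin r × Bool)) :
    FreeGroup.mk (a :: l) = letterVal FreeGroup.of a * FreeGroup.mk l := by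
  rw [← mk_singleton, FreeGroup.mul_mk]; rfl

theorem coe_letterVal (a : Fin r × Bool) :
    ((letterVal FreeGroup.of a : FreeGroup (Fin r)) : FreeGroup (Fin r) ⧸ N) =
      letterVal (quotGen N) a := by
  obtain ⟨i, _ | _⟩ := a <;> rfl

theorem coe_mk (l : List (Fin r × Bool)) :
    ((FreeGroup.mk l : FreeGroup (Fin r)) : FreeGroup (Fin r) ⧸ N) = wordVal (quotGen N) l := by
  induction l with
  | nil => rfl
  | cons a l ih => rw [mk_cons, QuotientGroup.mk_mul, ih, coe_letterVal, wordVal_cons]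

theorem foxImage_one (i : Fin r) (b : FreeGroup (Fin r) ⧸ N) : foxImage N i 1 b = 0 := by
  have h := foxImage_mul N i 1 1 b
  simpa using h

theorem foxImage_inv (i : Fin r) (g : FreeGroup (Fin r)) (b : FreeGroup (Fin r) ⧸ N) :
    foxImage N i g⁻¹ b = -foxImage N i g ((g : FreeGroup (Fin r) ⧸ N) * b) := by
  have h := foxImage_mul N i g g⁻¹ ((g : FreeGroup (Fin r) ⧸ N) * b)
  rw [mul_inv_cancel, foxImage_one, inv_mul_cancel_left] at h
  omega

open Classical in
theorem foxImage_of (i j : Fin r) (b : FreeGroup (Fin r) ⧸ N) :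
    foxImage N i (FreeGroup.of j) b = if j = i ∧ b = 1 then 1 else 0 := by
  rw [foxImage, foxDeriv_of]
  by_cases h : j = i
  · simp [h, MonoidAlgebra.one_def, Finsupp.single_apply, eq_comm]
  · simp [h]

/-- Both sides obey the same recursion: the first letter contributes its own edge, and the rest is
translated by that letter. The rule `∂x⁻¹/∂x = -x⁻¹` matches the convention that `x_i⁻¹` crosses the
edge based at its endpoint with sign `-1`. -/
theorem walkFlow_quotGen_apply (l : List (Fin r × Bool)) (c b : FreeGroup (Fin r) ⧸ N)
    (i : Fin r) : walkFlow (quotGen N) c l (b, i) = foxImage N i (FreeGroup.mk l) (c⁻¹ * b) := by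
  classical
  induction l generalizing c with
  | nil => rw [← FreeGroup.one_eq_mk, foxImage_one]; rfl
  | cons a l ih =>
    rw [walkFlow_cons, Finsupp.add_apply, ih, mk_cons, foxImage_mul, coe_letterVal, mul_inv_rev,
      mul_assoc]
    congr 1
    obtain ⟨j, _ | _⟩ := a
    · simp only [stepFlow, stepEdge, letterSign, letterVal, Bool.false_eq_true, if_false,
        foxImage_inv, foxImage_of, Finsupp.single_apply, Prod.mk.injEq]
      have : quotGen N j * (c⁻¹ * b) = 1 ↔ c * (quotGen N j)⁻¹ = b := by
        rw [mul_eq_one_iff_inv_eq, mul_inv_eq_iff_eq_mul, eq_inv_mul_iff_mul_eq,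
          ← mul_inv_eq_iff_eq_mul]
      change _ = -(if j = i ∧ quotGen N j * (c⁻¹ * b) = 1 then 1 else 0)
      simp only [this, and_comm]
      split_ifs <;> simp
    · simp only [stepFlow, stepEdge, letterSign, letterVal, if_true,
        foxImage_of, Finsupp.single_apply, Prod.mk.injEq, and_comm, inv_mul_eq_one]

theorem toFlow_magnusBase_mk (l : List (Fin r × Bool)) :
    toFlow (magnusBase N (FreeGroup.mk l)) = walkFlow (quotGen N) 1 l := by
  ext ⟨b, i⟩
  rw [toFlow_apply, magnusBase_apply, walkFlow_quotGen_apply, inv_one, one_mul]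

/-- The boundary of a walk depends only on its ends, and both walks go from `1` to the image of `g`.
-/
theorem boundary_toFlow_magnusBase (g : FreeGroup (Fin r)) (p : List (Fin r × Bool))
    (hp : wordVal (quotGen N) p = g) :
    boundary (quotGen N) (toFlow (magnusBase N g)) =
      boundary (quotGen N) (walkFlow (quotGen N) 1 p) := by
  classical
  rw [← FreeGroup.mk_toWord (x := g), coe_mk] at hp
  conv_lhs => rw [← FreeGroup.mk_toWord (x := g)]
  rw [toFlow_magnusBase_mk, boundary_walkFlow, boundary_walkFlow, hp]

/-! ### Injectivity -/

/-- The Schreier cocycle of a transversal of `N`. -/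
def schreier (b : FreeGroup (Fin r) ⧸ N) (g : FreeGroup (Fin r)) : N :=
  ⟨b.out * g * (b * (g : FreeGroup (Fin r) ⧸ N)).out⁻¹, by
    rw [← QuotientGroup.eq_one_iff]; simp⟩

/-- The intermediate coset representatives cancel, so in the abelianization the class of a word is a
sum over the steps of its walk. -/
theorem schreier_mul (b : FreeGroup (Fin r) ⧸ N) (g h : FreeGroup (Fin r)) :
    schreier N b (g * h) = schreier N b g * schreier N (b * (g : FreeGroup (Fin r) ⧸ N)) h := by
  apply Subtype.ext
  simp [schreier, mul_assoc]

theorem schreier_one (b : FreeGroup (Fin r) ⧸ N) : schreier N b 1 = 1 := by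
  apply Subtype.ext
  simp [schreier]

theorem schreier_inv (b : FreeGroup (Fin r) ⧸ N) (g : FreeGroup (Fin r)) :
    schreier N b g⁻¹ = (schreier N (b * (g : FreeGroup (Fin r) ⧸ N)⁻¹) g)⁻¹ := by
  rw [eq_inv_iff_mul_eq_one]
  have h := schreier_mul N b g⁻¹ g
  rw [inv_mul_cancel, schreier_one] at h
  exact h.symm

/-- The homomorphism from flows to the abelianization of `N` that sends an edge to the class of
its Schreier generator. -/
def flowToAb : ((FreeGroup (Fin r) ⧸ N) × Fin r →₀ ℤ) →+ Additive (Abelianization N) :=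
  Finsupp.liftAddHom fun e =>
    (smulAddHom ℤ _).flip
      (Additive.ofMul (Abelianization.of (schreier N e.1 (FreeGroup.of e.2))))

/-- By the cocycle identity, the class of the cocycle in the abelianization of `N` depends only on
the flow. This is what makes the flow detect elements of `N` modulo `[N, N]`. -/
theorem flowToAb_walkFlow (b : FreeGroup (Fin r) ⧸ N) (l : List (Fin r × Bool)) :
    flowToAb N (walkFlow (quotGen N) b l) =
      Additive.ofMul (Abelianization.of (schreier N b (FreeGroup.mk l))) := by
  induction l generalizing b with
  | nil =>
    rw [← FreeGroup.one_eq_mk, schreier_one]; simp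
  | cons a l ih =>
    rw [walkFlow_cons, map_add, ih, mk_cons, schreier_mul, map_mul, ofMul_mul, coe_letterVal]
    congr 1
    obtain ⟨j, _ | _⟩ := a
    · simp only [stepFlow, stepEdge, letterSign, letterVal, Bool.false_eq_true, if_false,
        schreier_inv, flowToAb, Finsupp.liftAddHom_apply_single]
      simp
      rfl
    · simp [stepFlow, stepEdge, letterSign, letterVal, flowToAb]

theorem magnus_injective : Function.Injective (magnus N) := by
  rw [injective_iff_map_eq_one]
  intro w hw
  induction w using QuotientGroup.induction_on with
  | H g =>
    rw [magnus_mk] at hw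
    have hbase : magnusBase N g = 0 := congrArg (fun z => z.left.toAdd) hw
    have htop : (g : FreeGroup (Fin r) ⧸ N) = 1 := congrArg (fun z => z.right) hw
    rw [QuotientGroup.eq_one_iff]
    have key : Abelianization.of (schreier N 1 g) = 1 := by
      have h := flowToAb_walkFlow N 1 g.toWord
      rw [← toFlow_magnusBase_mk, FreeGroup.mk_toWord, hbase, map_zero, map_zero] at h
      exact h.symm
    have hmem : schreier N 1 g ∈ commutator N := by
      rwa [← Abelianization.ker_of, MonoidHom.mem_ker]
    have h2 : ((schreier N 1 g : N) : FreeGroup (Fin r)) ∈ ⁅N, N⁆ := by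
      rw [← Subgroup.map_subtype_commutator]
      exact Subgroup.mem_map_of_mem _ hmem
    -- The chosen representative of the trivial coset need not be `1`, so only a conjugate of `g` is
    -- obtained; normality of `⁅N, N⁆` removes the conjugation.
    have h3 : ((schreier N 1 g : N) : FreeGroup (Fin r)) =
        (1 : FreeGroup (Fin r) ⧸ N).out * g * (1 : FreeGroup (Fin r) ⧸ N).out⁻¹ := by
      simp [schreier, htop]
    rw [h3] at h2
    have hn : (⁅N, N⁆ : Subgroup (FreeGroup (Fin r))).Normal := inferInstance
    simpa [mul_assoc] using hn.conj_mem _ h2 (1 : FreeGroup (Fin r) ⧸ N).out⁻¹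

end FlowMagnus

/-! ### Word lengths -/

theorem wordLength_le {G : Type*} [Group G] {S : Set G} (l : List G)
    (hl : ∀ y ∈ l, y ∈ S ∨ y⁻¹ ∈ S) : wordLength S l.prod ≤ l.length :=
  Nat.sInf_le ⟨l, hl, rfl, rfl⟩

theorem wordLength_map_le {G H : Type*} [Group G] [Group H] {S : Set G} {T : Set H}
    (hS : Subgroup.closure S = ⊤) (φ : G →* H) (k : ℕ)
    (h : ∀ s ∈ S, ∃ l : List H, (∀ y ∈ l, y ∈ T ∨ y⁻¹ ∈ T) ∧ l.prod = φ s ∧ l.length ≤ k)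
    (g : G) : wordLength T (φ g) ≤ k * wordLength S g := by
  obtain ⟨l, hl, rfl, hlen⟩ := wordLength_spec hS g
  suffices H : ∃ m : List H, (∀ y ∈ m, y ∈ T ∨ y⁻¹ ∈ T) ∧ m.prod = φ l.prod ∧
      m.length ≤ k * l.length by
    obtain ⟨m, hm, hp, hk⟩ := H
    rw [← hp, ← hlen]
    exact (wordLength_le m hm).trans hk
  clear hlen
  induction l with
  | nil => exact ⟨[], by simp, by simp, by simp⟩
  | cons a l ih =>
    obtain ⟨m, hm, hp, hk⟩ := ih fun y hy => hl y (List.mem_cons_of_mem _ hy)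
    obtain ⟨c, hc, hcp, hck⟩ : ∃ c : List H, (∀ y ∈ c, y ∈ T ∨ y⁻¹ ∈ T) ∧ c.prod = φ a ∧
        c.length ≤ k := by
      rcases hl a List.mem_cons_self with ha | ha
      · exact h a ha
      · obtain ⟨c, hc, hcp, hck⟩ := h _ ha
        refine ⟨(c.map (·⁻¹)).reverse, ?_, ?_, by simpa using hck⟩
        · intro y hy
          simp only [List.mem_reverse, List.mem_map] at hy
          obtain ⟨z, hz, rfl⟩ := hy
          rw [inv_inv]
          exact (hc z hz).symm
        · rw [← List.prod_inv_reverse, hcp, map_inv, inv_inv]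
    refine ⟨c ++ m, ?_, by simp [hcp, hp], ?_⟩
    · intro y hy
      rcases List.mem_append.1 hy with hy | hy
      · exact hc y hy
      · exact hm y hy
    · rw [List.length_append, List.length_cons, mul_add, mul_one]; omega

section WreathWords

variable {d r : ℕ}

local notation "gen" => quotGen (derivedSeries (FreeGroup (Fin r)) d)

theorem wreathGens_cases {y : Wreath (Fin r → ℤ) (FreeSolvable d r)}
    (hy : y ∈ wreathGens d r ∨ y⁻¹ ∈ wreathGens d r) :
    (∃ (i : Fin r) (n : ℤ), n.natAbs = 1 ∧ y = wreathBase (Pi.single i n)) ∨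
      ∃ a : Fin r × Bool, y = wreathTop (letterVal gen a) := by
  have hneg : ∀ i : Fin r, (wreathBase (Pi.single i 1) : Wreath (Fin r → ℤ) (FreeSolvable d r))⁻¹ =
      wreathBase (Pi.single i (-1)) := by
    intro i
    rw [wreathBase, ← map_inv, ← ofAdd_neg, ← Finsupp.single_neg, ← Pi.single_neg]; rfl
  rcases hy with (⟨i, rfl⟩ | ⟨_, ⟨i, rfl⟩, rfl⟩) | (⟨i, hi⟩ | ⟨_, ⟨i, rfl⟩, hi⟩)
  · exact Or.inl ⟨i, 1, rfl, rfl⟩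
  · exact Or.inr ⟨(i, true), rfl⟩
  · exact Or.inl ⟨i, -1, rfl, by rw [← hneg, ← inv_inj, ← hi]; simp⟩
  · refine Or.inr ⟨(i, false), ?_⟩
    rw [← inv_inj, ← hi, wreathTop, wreathTop, ← map_inv]
    simp [letterVal, quotGen]

/-- A word in the generators of the wreath product moves along a walk in the Cayley graph of the
top group and changes the base function only at the vertices of the walk. -/
theorem exists_walk_of_wreath_word (l : List (Wreath (Fin r → ℤ) (FreeSolvable d r)))
    (hl : ∀ y ∈ l, y ∈ wreathGens d r ∨ y⁻¹ ∈ wreathGens d r) :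
    ∃ p : List (Fin r × Bool), wordVal gen p = l.prod.right ∧
      p.length + flowNorm (toFlow l.prod.left.toAdd) ≤ l.length ∧
      ∀ e, toFlow l.prod.left.toAdd e ≠ 0 → Visits gen p e.1 := by
  induction l using List.reverseRecOn with
  | nil => exact ⟨[], rfl, by simp [flowNorm], by simp⟩
  | append_singleton l y ih =>
    obtain ⟨p, hp, hlen, hv⟩ := ih fun z hz => hl z (by simp [hz])
    rcases wreathGens_cases (hl y (by simp)) with ⟨i, n, hn, rfl⟩ | ⟨a, rfl⟩
    -- Right multiplication by `a_i ^ n` changes the function only at the current position, which is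
    -- the end of the walk `p`.
    · have hleft : toFlow ((l ++ [wreathBase (Pi.single i n)]).prod.left.toAdd) =
          toFlow l.prod.left.toAdd + Finsupp.single (l.prod.right, i) n := by
        rw [← toFlow_single, ← map_add, List.prod_append, List.prod_singleton,
          SemidirectProduct.mul_left, toAdd_mul]
        congr 2
        change Finsupp.equivMapDomain (Equiv.mulLeft l.prod.right) (Finsupp.single 1 _) = _
        simp
      refine ⟨p, by simp [hp, wreathBase], ?_, fun e he => ?_⟩
      · have := flowNorm_add_le (toFlow l.prod.left.toAdd) (Finsupp.single (l.prod.right, i) n)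
        rw [flowNorm_single, hn] at this
        rw [hleft, List.length_append, List.length_singleton]
        omega
      · by_cases h : toFlow l.prod.left.toAdd e = 0
        · rw [hleft, Finsupp.add_apply, h, zero_add] at he
          have : (l.prod.right, i) = e := by
            by_contra hne; simp [hne] at he
          rw [← this, ← hp]
          exact visits_end _ p
        · exact hv e h
    · have hleft : (l ++ [wreathTop (letterVal gen a)]).prod.left = l.prod.left := by
        simp [wreathTop]
      refine ⟨p ++ [a], by simp [hp, wreathTop], ?_, fun e he => ?_⟩
      · rw [hleft, List.length_append, List.length_append, List.length_singleton,
          List.length_singleton]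
        omega
      · rw [hleft] at he
        exact (hv e he).append _ _

theorem wordLength_freeSolvable_mk_le (k : ℕ) (l : List (Fin r × Bool)) :
    wordLength (freeSolvableGens k r) ((FreeGroup.mk l : FreeGroup (Fin r)) : FreeSolvable k r) ≤
      l.length := by
  rw [coe_mk, wordVal,
    ← List.length_map (f := letterVal (quotGen (derivedSeries (FreeGroup (Fin r)) k)))]
  refine wordLength_le _ fun y hy => ?_
  obtain ⟨⟨i, b⟩, -, rfl⟩ := List.mem_map.1 hy
  cases b
  · right; simp only [letterVal, Bool.false_eq_true, if_false, inv_inv]; exact ⟨i, rfl⟩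
  · left; exact ⟨i, rfl⟩

theorem wordLength_le_two_mul_magnus (w : FreeSolvable (d + 1) r) :
    wordLength (freeSolvableGens (d + 1) r) w ≤
      2 * wordLength (wreathGens d r) (freeSolvableMagnus d r w) := by
  classical
  obtain ⟨l, hl, hprod, hlen⟩ :=
    wordLength_spec (closure_wreathGens d r) (freeSolvableMagnus d r w)
  obtain ⟨p, hp, hpl, hv⟩ := exists_walk_of_wreath_word l hl
  rw [hprod] at hp hpl hv
  obtain ⟨g, rfl⟩ := QuotientGroup.mk_surjective w
  rw [← hlen]
  have hm : freeSolvableMagnus d r (g : FreeSolvable (d + 1) r) =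
    ⟨Multiplicative.ofAdd (magnusBase _ g), (g : FreeSolvable d r)⟩ := rfl
  rw [hm] at hp hpl hv
  simp only [toAdd_ofAdd] at hp hpl hv
  set f := toFlow (magnusBase (derivedSeries (FreeGroup (Fin r)) d) g) with hf
  -- The difference is a circulation. An edge in its support is either crossed by `p` or carries a
  -- nonzero value of `f`, hence meets `p` in both cases.
  obtain ⟨m, hm1, hm2, hm3⟩ := exists_walk_add gen _ (f - walkFlow gen 1 p) le_rfl
    (by rw [map_sub, hf, boundary_toFlow_magnusBase _ g p hp, sub_self]) p (by
      intro e he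
      by_cases h : walkFlow gen 1 p e = 0
      · rw [Finsupp.sub_apply, h, sub_zero] at he
        exact Or.inl (hv e he)
      · exact visits_of_walkFlow_ne_zero _ p e h)
  have hnorm : flowNorm (f - walkFlow gen 1 p) ≤ flowNorm f + p.length := by
    rw [sub_eq_add_neg]
    refine (flowNorm_add_le _ _).trans ?_
    rw [flowNorm_neg]
    exact Nat.add_le_add_left (flowNorm_walkFlow_le _ _ _) _
  rw [add_sub_cancel, ← toFlow_magnusBase_mk, hf] at hm1
  have heq : ((FreeGroup.mk m : FreeGroup (Fin r)) : FreeSolvable (d + 1) r) = g := by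
    apply magnus_injective (derivedSeries (FreeGroup (Fin r)) d)
    refine (magnus_mk _ _).trans (Eq.trans ?_ (magnus_mk _ _).symm)
    rw [toFlow_injective hm1, coe_mk, hm2, hp]
  rw [← heq]
  refine (wordLength_freeSolvable_mk_le (d + 1) m).trans ?_
  -- `|m| ≤ |p| + ‖f - walkFlow p‖ ≤ 2|p| + ‖f‖ ≤ 2(|p| + ‖f‖)`, and `|p| + ‖f‖` is at most the
  -- length of `l`.
  omega

theorem wordLength_magnus_le (w : FreeSolvable (d + 1) r) :
    wordLength (wreathGens d r) (freeSolvableMagnus d r w) ≤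
      2 * wordLength (freeSolvableGens (d + 1) r) w := by
  refine wordLength_map_le (closure_freeSolvableGens (d + 1) r) _ 2 ?_ w
  rintro _ ⟨i, rfl⟩
  refine ⟨[wreathBase (Pi.single i 1), wreathTop ((FreeGroup.of i : FreeGroup (Fin r)) :)],
    ?_, ?_, by simp⟩
  · intro y hy
    simp only [List.mem_cons, List.not_mem_nil, or_false] at hy
    rcases hy with rfl | rfl
    · exact Or.inl (Or.inl ⟨i, rfl⟩)
    · exact Or.inl (Or.inr ⟨_, ⟨i, rfl⟩, rfl⟩)
  · rw [List.prod_cons, List.prod_singleton]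
    exact (magnus_of _ i).symm

end WreathWords

end MagnusQI

end

/-! ### The quasi-isometric embedding -/

theorem mainTheorem2 (d r : ℕ) :
    Function.Injective (MagnusQI.freeSolvableMagnus d r) ∧
    MagnusQI.IsQuasiIsometricEmbedding
      (MagnusQI.wordDist (MagnusQI.freeSolvableGens (d + 1) r))
      (MagnusQI.wordDist (MagnusQI.wreathGens d r))
      (MagnusQI.freeSolvableMagnus d r) ∧
    ∀ w : MagnusQI.FreeSolvable (d + 1) r,
      1 / (2 * ((r : ℝ) + 1)) * MagnusQI.wordLength (MagnusQI.freeSolvableGens (d + 1) r) w ≤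
        MagnusQI.wordLength (MagnusQI.wreathGens d r) (MagnusQI.freeSolvableMagnus d r w) ∧
      (MagnusQI.wordLength (MagnusQI.wreathGens d r) (MagnusQI.freeSolvableMagnus d r w) : ℝ) ≤
        3 * MagnusQI.wordLength (MagnusQI.freeSolvableGens (d + 1) r) w := by
  have hlow : ∀ w, 1 / (2 * ((r : ℝ) + 1)) *
      MagnusQI.wordLength (MagnusQI.freeSolvableGens (d + 1) r) w ≤
        MagnusQI.wordLength (MagnusQI.wreathGens d r) (MagnusQI.freeSolvableMagnus d r w) := by
    intro w
    have h : (MagnusQI.wordLength (MagnusQI.freeSolvableGens (d + 1) r) w : ℝ) ≤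
        2 * MagnusQI.wordLength (MagnusQI.wreathGens d r) (MagnusQI.freeSolvableMagnus d r w) :=
      mod_cast MagnusQI.wordLength_le_two_mul_magnus w
    rw [one_div, inv_mul_le_iff₀ (by positivity)]
    refine h.trans (mul_le_mul_of_nonneg_right ?_ (Nat.cast_nonneg _))
    have : (0 : ℝ) ≤ r := Nat.cast_nonneg r
    linarith
  have hup : ∀ w, (MagnusQI.wordLength (MagnusQI.wreathGens d r)
      (MagnusQI.freeSolvableMagnus d r w) : ℝ) ≤
        3 * MagnusQI.wordLength (MagnusQI.freeSolvableGens (d + 1) r) w := by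
    intro w
    have h := MagnusQI.wordLength_magnus_le w
    exact_mod_cast h.trans (Nat.mul_le_mul_right _ (by norm_num))
  -- This `L` is at least `2(r + 1)` and, since `r ≥ 0`, at least `3`, so it serves both
  -- inequalities; the bounds on lengths have no additive term, so `C = 0`.
  refine ⟨MagnusQI.magnus_injective _, ⟨2 * (r + 1) + 1, 0, ?_, le_rfl, fun g h => ?_⟩,
    fun w => ⟨hlow w, hup w⟩⟩
  · have : (0 : ℝ) ≤ r := Nat.cast_nonneg r
    linarith
  · have hr : (0 : ℝ) ≤ r := Nat.cast_nonneg r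
    have hL := hlow (g⁻¹ * h)
    have hU := hup (g⁻¹ * h)
    rw [map_mul, map_inv] at hL hU
    rw [sub_zero, add_zero]
    constructor
    · refine le_trans (mul_le_mul_of_nonneg_right ?_ (Nat.cast_nonneg _)) hL
      rw [← one_div]
      exact one_div_le_one_div_of_le (by positivity) (by linarith)
    · refine hU.trans (mul_le_mul_of_nonneg_right ?_ (Nat.cast_nonneg _))
      linarith
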